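/- Let $q$ be a prime power, let $n\ge 2$ be an integer, and let $\mathrm{PG}(n,q)$ be the $n$-dimensional projective space over $\mathbb{F}_q$. For an integer $m$, a partial $m$-cover of $\mathrm{PG}(n,q)$ is a set $\mathcal S$ of $m$ different hyperplanes of $\mathrm{PG}(n,q)$ such that at least one point lies on no hyperplane of $\mathcal S$; the points lying on no hyperplane of $\mathcal S$ are the holes of $\mathcal S$, and $\mathcal H_{\mathcal S}$ denotes the set of holes. For an integer $x$, let $(A_x)$ be the following property: if $\mathcal S$ is a partial $(q+b)$-cover of $\mathrm{PG}(2,q)$, where $b$ is an integer with $b\le x<(q-2)/3$, and $\mathcal S$ has at most $q+b$ holes, then $q-b\le|\mathcal H_{\mathcal S}|\le q$ and the holes of $\mathcal S$ are collinear. 1. Let $a$ be an integer and assume $(A_x)$ for all integers $x\le a$. Then every partial $(q+a)$-cover of $\mathrm{PG}(n,q)$ has at least $q^{n-1}-aq^{n-2}$ holes. 2. If $q>13$ and $a$ is an integer with $a\le (q-10)/4$, then (without further assumption) every partial $(q+a)$-cover of $\mathrm{PG}(n,q)$ has at least $q^{n-1}-aq^{n-2}$ holes. 3. The bound is sharp: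 for every integer $a$ with $0\le a<q$ there is a partial $(q+a)$-cover of $\mathrm{PG}(n,q)$ with exactly $q^{n-1}-aq^{n-2}$ holes. -/

import Mathlib

/-- The points of the projective space `PG(n, q)` over the field `K` with `q` elements:
the one-dimensional subspaces of `K ^ (n + 1)`. -/
abbrev PGPoint (n : ℕ) (K : Type*) [Field K] : Type _ :=
  Projectivization K (Fin (n + 1) → K)

/-- The hyperplanes of `PG(n, q)`: the `n`-dimensional subspaces of `K ^ (n + 1)`. -/
def PGHyperplane (n : ℕ) (K : Type*) [Field K] : Type _ :=
  {H : Submodule K (Fin (n + 1) → K) // Module.finrank K H = n}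

/-- The projective point `P` lies on the projective subspace given by the linear subspace `W`. -/
def PGPoint.LiesOn {n : ℕ} {K : Type*} [Field K] (P : PGPoint n K)
    (W : Submodule K (Fin (n + 1) → K)) : Prop :=
  Projectivization.submodule P ≤ W

/-- The holes of a set `S` of hyperplanes: the points on no hyperplane of `S`. -/
def holes {n : ℕ} {K : Type*} [Field K] (S : Finset (PGHyperplane n K)) : Set (PGPoint n K) :=
  {P | ∀ H ∈ S, ¬ PGPoint.LiesOn P H.1}

/-- A partial `m`-cover of `PG(n, q)`: a set of `m` (different) hyperplanes with at least one
hole. The size is an integer, so that it can be written as `q + a` with `a` an integer. -/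
structure IsPartialCover {n : ℕ} {K : Type*} [Field K] (m : ℤ)
    (S : Finset (PGHyperplane n K)) : Prop where
  card_eq : (S.card : ℤ) = m
  exists_hole : (holes S).Nonempty

/-- A set of points is collinear if some line (a two-dimensional linear subspace) contains it. -/
def PGCollinear {n : ℕ} {K : Type*} [Field K] (X : Set (PGPoint n K)) : Prop :=
  ∃ L : Submodule K (Fin (n + 1) → K), Module.finrank K L = 2 ∧ ∀ P ∈ X, PGPoint.LiesOn P L

/-- The property `(A_x)` of the plane `PG(2, q)`, where `q = |K|`: if `S` is a partial
`(q + b)`-cover of `PG(2, q)`, `b ≤ x < (q - 2) / 3`, with at most `q + b` holes, then the number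
of holes is at least `q - b` and at most `q`, and the holes are collinear. -/
def PropertyA (K : Type*) [Field K] (x : ℤ) : Prop :=
  ∀ (b : ℤ) (S : Finset (PGHyperplane 2 K)),
    b ≤ x → (x : ℚ) < ((Nat.card K : ℚ) - 2) / 3 →
    IsPartialCover ((Nat.card K : ℤ) + b) S →
    ((holes S).ncard : ℤ) ≤ (Nat.card K : ℤ) + b →
      (Nat.card K : ℤ) - b ≤ ((holes S).ncard : ℤ) ∧
      (holes S).ncard ≤ Nat.card K ∧
      PGCollinear (holes S)

/-! Send one hyperplane of the cover to infinity. The product of affine forms of the others is a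
polynomial in `n` variables of degree at most `q + a - 1`; it is nonzero at a hole, and its nonzeros
are affine holes (`IsPartialCover.exists_polynomial`). The lower bound, for every integer `a`, is
thus the minimum distance of a generalized Reed-Muller code (`sub_mul_pow_le_sq_mul_nonzeroCount`)
when `0 ≤ a < q`, and the Schwartz-Zippel bound when `a < 0`; for `a ≥ q` it is trivial. Both counts
go by induction on the number of variables, peeling off the first one
(`exists_mul_nonzeroCount_le`). For sharpness, the affine holes form a box with sides `1`, `q - a`,
`q`, ..., `q`. -/

/-! ### Nonzeros of polynomials over a finite field -/

open MvPolynomial in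
/-- The number of points at which a polynomial over a finite field does not vanish. -/
noncomputable def nonzeroCount {K : Type*} [Field K] [Fintype K] [DecidableEq K] {n : ℕ}
    (p : MvPolynomial (Fin n) K) : ℕ :=
  (Finset.univ.filter fun x : Fin n → K => eval x p ≠ 0).card

/-- Positive exponents are reduced modulo `q - 1` into `1, ..., q - 1`, never to `0`, so that the
identity survives at `y = 0`. -/
lemma FiniteField.pow_eq_pow_reduced {K : Type*} [Field K] [Fintype K] (y : K) (k : ℕ) :
    y ^ k = y ^ (if k = 0 then 0 else (k - 1) % (Fintype.card K - 1) + 1) := by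
  split_ifs with hk
  · rw [hk]
  obtain ⟨k, rfl⟩ := Nat.exists_eq_succ_of_ne_zero hk
  rcases eq_or_ne y 0 with rfl | hy
  · simp
  rw [Nat.succ_eq_add_one, Nat.add_sub_cancel, pow_succ, pow_succ]
  congr 1
  conv_lhs => rw [← Nat.div_add_mod k (Fintype.card K - 1), pow_add, pow_mul,
    FiniteField.pow_card_sub_one_eq_one y hy, one_pow, one_mul]

lemma Polynomial.card_sub_le_card_filter_eval_ne_zero {K : Type*} [Field K] [Fintype K]
    [DecidableEq K] {p : Polynomial K} (hp : p ≠ 0) :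
    Fintype.card K - p.natDegree ≤ (Finset.univ.filter fun y : K => p.eval y ≠ 0).card := by
  have h1 : (Finset.univ.filter fun y : K => p.eval y = 0).card ≤ p.natDegree := by
    apply Polynomial.card_le_degree_of_subset_roots
    intro y hy
    simpa [Polynomial.mem_roots hp] using hy
  have h2 := Finset.card_filter_add_card_filter_not (s := (Finset.univ : Finset K))
    (fun y => p.eval y = 0)
  rw [Finset.card_univ] at h2
  simp only [ne_eq]
  omega

open MvPolynomial in
/-- A polynomial over a finite field as a function: the exponents of the first variable can be
taken smaller than the size of the field, without raising the total degree. -/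
lemma MvPolynomial.exists_eval_cons_eq_sum {K : Type*} [Field K] [Fintype K] {n : ℕ}
    (p : MvPolynomial (Fin (n + 1)) K) :
    ∃ g : ℕ → MvPolynomial (Fin n) K,
      (∀ y s, eval (Fin.cons y s) p =
        ∑ i ∈ Finset.range (Fintype.card K), eval s (g i) * y ^ i) ∧
      ∀ i, g i ≠ 0 → (g i).totalDegree + i ≤ p.totalDegree := by
  classical
  set r : ℕ → ℕ := fun k => if k = 0 then 0 else (k - 1) % (Fintype.card K - 1) + 1 with hr
  have hq : 1 < Fintype.card K := Fintype.one_lt_card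
  have hrq : ∀ k, r k < Fintype.card K := by
    intro k
    have := Nat.mod_lt (k - 1) (y := Fintype.card K - 1) (by omega)
    simp only [hr]
    split_ifs <;> omega
  have hrk : ∀ k, r k ≤ k := by
    intro k
    have := Nat.mod_le (k - 1) (Fintype.card K - 1)
    simp only [hr]
    split_ifs <;> omega
  set c := finSuccEquiv K n p with hc
  refine ⟨fun i => ∑ k ∈ (Finset.range (c.natDegree + 1)).filter (fun k => r k = i), c.coeff k,
    ?_, ?_⟩
  · intro y s
    rw [eval_eq_eval_mv_eval', Polynomial.eval_eq_sum_range'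
      (Nat.lt_succ_of_le Polynomial.natDegree_map_le)]
    rw [← Finset.sum_fiberwise_of_maps_to
      (g := r) (t := Finset.range (Fintype.card K)) (fun k _ => Finset.mem_range.2 (hrq k))]
    refine Finset.sum_congr rfl fun i _ => ?_
    rw [map_sum, Finset.sum_mul]
    refine Finset.sum_congr rfl fun k hk => ?_
    rw [Polynomial.coeff_map, FiniteField.pow_eq_pow_reduced y k, ← (Finset.mem_filter.1 hk).2]
  · intro i hi
    obtain ⟨k₀, hk₀, hck₀⟩ := Finset.exists_ne_zero_of_sum_ne_zero hi
    have hle : ∀ k, r k = i → c.coeff k ≠ 0 → (c.coeff k).totalDegree + i ≤ p.totalDegree := by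
      intro k hk hck
      have h1 := totalDegree_coeff_finSuccEquiv_add_le p k hck
      rw [← hc] at h1
      have h2 := hrk k
      omega
    have h0 := hle k₀ (Finset.mem_filter.1 hk₀).2 hck₀
    have : (∑ k ∈ (Finset.range (c.natDegree + 1)).filter (fun k => r k = i),
        c.coeff k).totalDegree ≤ p.totalDegree - i := by
      refine totalDegree_finsetSum_le fun k hk => ?_
      by_cases hck : c.coeff k = 0
      · simp [hck]
      · have := hle k (Finset.mem_filter.1 hk).2 hck
        omega
    beta_reduce
    omega

-- Let `j` be the top exponent of the first variable, after reduction below `q`, and `g` its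
-- coefficient. Over each nonzero of `g` the slice is a univariate polynomial of degree `j`, with at
-- least `q - j` nonzeros.
open MvPolynomial in
lemma exists_mul_nonzeroCount_le {K : Type*} [Field K] [Fintype K] [DecidableEq K] {n : ℕ}
    (p : MvPolynomial (Fin (n + 1)) K) (hp : ∃ x, eval x p ≠ 0) :
    ∃ (j : ℕ) (g : MvPolynomial (Fin n) K), j < Fintype.card K ∧ (∃ x, eval x g ≠ 0) ∧
      g.totalDegree + j ≤ p.totalDegree ∧
      (Fintype.card K - j) * nonzeroCount g ≤ nonzeroCount p := by
  obtain ⟨g, hg, hdeg⟩ := p.exists_eval_cons_eq_sum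
  -- Coefficients count only if nonzero as functions: a nonzero polynomial may vanish everywhere.
  set J := (Finset.range (Fintype.card K)).filter (fun i => ∃ s, eval s (g i) ≠ 0) with hJ
  have hJne : J.Nonempty := by
    obtain ⟨x, hx⟩ := hp
    rw [← Fin.cons_self_tail x, hg] at hx
    obtain ⟨i, hi, hne⟩ := Finset.exists_ne_zero_of_sum_ne_zero hx
    exact ⟨i, Finset.mem_filter.2 ⟨hi, _, left_ne_zero_of_mul hne⟩⟩
  set j := J.max' hJne
  have hj := Finset.mem_filter.1 (J.max'_mem hJne)
  obtain ⟨hjq, s₀, hs₀⟩ := hj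
  have hjq : j < Fintype.card K := Finset.mem_range.1 hjq
  have hgt : ∀ i, i < Fintype.card K → j < i → ∀ s, eval s (g i) = 0 := by
    intro i hi hji s
    by_contra h
    exact absurd (J.le_max' i (Finset.mem_filter.2 ⟨Finset.mem_range.2 hi, s, h⟩)) (by omega)
  refine ⟨j, g j, hjq, ⟨s₀, hs₀⟩, hdeg j (fun h => hs₀ (by rw [show J.max' hJne = j from rfl, h,
    map_zero])), ?_⟩
  have hslice : ∀ s, eval s (g j) ≠ 0 → Fintype.card K - j ≤
      (Finset.univ.filter fun y : K => eval (Fin.cons y s) p ≠ 0).card := by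
    intro s hs
    set f : Polynomial K :=
      ∑ i ∈ Finset.range (Fintype.card K), Polynomial.C (eval s (g i)) * Polynomial.X ^ i with hf
    have hcoeff : f.coeff j = eval s (g j) := by
      simp [hf, Polynomial.finsetSum_coeff, Polynomial.coeff_C_mul, Polynomial.coeff_X_pow, hjq]
    have hf0 : f ≠ 0 := fun h => hs (by rw [← hcoeff, h, Polynomial.coeff_zero])
    have hfd : f.natDegree ≤ j := by
      refine Polynomial.natDegree_sum_le_of_forall_le _ _ fun i hi => ?_
      rcases le_or_gt i j with hij | hij
      · exact (Polynomial.natDegree_C_mul_X_pow_le _ _).trans hij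
      · simp [hgt i (Finset.mem_range.1 hi) hij s]
    have h := Polynomial.card_sub_le_card_filter_eval_ne_zero hf0
    have he : ∀ y, f.eval y = eval (Fin.cons y s) p := by
      intro y
      simp [hf, hg, Polynomial.eval_finsetSum]
    simp only [he] at h
    omega
  calc (Fintype.card K - j) * nonzeroCount (g j)
      ≤ ((Finset.univ.filter fun s : Fin n → K => eval s (g j) ≠ 0).sigma fun s =>
          Finset.univ.filter fun y : K => eval (Fin.cons y s) p ≠ 0).card := by
        rw [Finset.card_sigma, mul_comm, nonzeroCount, ← smul_eq_mul]
        exact Finset.card_nsmul_le_sum _ _ _ fun s hs => hslice s (Finset.mem_filter.1 hs).2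
    _ ≤ nonzeroCount p := by
        refine Finset.card_le_card_of_injOn (fun z => Fin.cons z.2 z.1) ?_ ?_
        · intro z hz
          simp only [Finset.coe_sigma, Finset.coe_filter, Set.mem_sigma_iff] at hz
          simpa using hz.2
        · rintro ⟨s, y⟩ - ⟨s', y'⟩ - h
          obtain ⟨rfl, rfl⟩ := Fin.cons_injective2 h
          rfl

open MvPolynomial in
lemma nonzeroCount_pos {K : Type*} [Field K] [Fintype K] [DecidableEq K] {n : ℕ}
    {p : MvPolynomial (Fin n) K} (hp : ∃ x, eval x p ≠ 0) : 0 < nonzeroCount p := by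
  obtain ⟨x, hx⟩ := hp
  exact Finset.card_pos.2 ⟨x, by simpa using hx⟩

open MvPolynomial in
/-- A polynomial of total degree at most `d` that is not identically zero as a function on `K ^ n`
has at least `(q - d) * q ^ (n - 1)` nonzeros. -/
lemma sub_mul_pow_le_mul_nonzeroCount {K : Type*} [Field K] [Fintype K] [DecidableEq K] {n : ℕ}
    (p : MvPolynomial (Fin n) K) (hp : ∃ x, eval x p ≠ 0) (d : ℤ) (hd : p.totalDegree ≤ d) :
    ((Fintype.card K : ℤ) - d) * (Fintype.card K : ℤ) ^ n ≤
      (Fintype.card K : ℤ) * nonzeroCount p := by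
  induction n generalizing d with
  | zero =>
    have h1 : (1 : ℤ) ≤ nonzeroCount p := by exact_mod_cast nonzeroCount_pos hp
    have h2 : (0 : ℤ) ≤ p.totalDegree := by positivity
    have h3 : (0 : ℤ) ≤ Fintype.card K := by positivity
    nlinarith
  | succ n ih =>
    obtain ⟨j, g, hj, hg, hdeg, hle⟩ := exists_mul_nonzeroCount_le p hp
    have h := ih g hg (d - j) (by push_cast [← @Nat.cast_le ℤ] at hdeg; linarith)
    zify [hj.le] at hle
    have hj' : (j : ℤ) < Fintype.card K := by exact_mod_cast hj
    have hdj : (j : ℤ) ≤ d := by zify at hdeg; linarith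
    generalize (Fintype.card K : ℤ) = Q at *
    have hj0 : (0 : ℤ) ≤ j := by positivity
    have hQn : 0 ≤ Q ^ n := pow_nonneg (by linarith) n
    calc (Q - d) * Q ^ (n + 1) = (Q * (Q - d)) * Q ^ n := by ring
      _ ≤ ((Q - j) * (Q - (d - j))) * Q ^ n := by
          refine mul_le_mul_of_nonneg_right ?_ hQn
          -- The two sides differ by `j * (d - j)`.
          nlinarith [mul_nonneg hj0 (sub_nonneg.2 hdj)]
      _ = (Q - j) * ((Q - (d - j)) * Q ^ n) := by ring
      _ ≤ (Q - j) * (Q * nonzeroCount g) := mul_le_mul_of_nonneg_left h (by linarith)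
      _ = Q * ((Q - j) * nonzeroCount g) := by ring
      _ ≤ Q * nonzeroCount p := mul_le_mul_of_nonneg_left hle (by linarith)

open MvPolynomial in
/-- The minimum distance of the generalized Reed-Muller code of degree `q - 1 + a` with
`0 ≤ a < q`: a polynomial of that degree that is not identically zero as a function on
`K ^ n` has at least `(q - a) * q ^ (n - 2)` nonzeros. -/
lemma sub_mul_pow_le_sq_mul_nonzeroCount {K : Type*} [Field K] [Fintype K] [DecidableEq K] {n : ℕ}
    (p : MvPolynomial (Fin (n + 1)) K) (hp : ∃ x, eval x p ≠ 0) (a : ℤ) (ha : 0 ≤ a)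
    (haq : a < Fintype.card K) (hd : p.totalDegree ≤ (Fintype.card K : ℤ) - 1 + a) :
    ((Fintype.card K : ℤ) - a) * (Fintype.card K : ℤ) ^ n ≤
      (Fintype.card K : ℤ) * nonzeroCount p := by
  induction n generalizing a with
  | zero =>
    have h1 : (1 : ℤ) ≤ nonzeroCount p := by exact_mod_cast nonzeroCount_pos hp
    nlinarith
  | succ n ih =>
    obtain ⟨j, g, hj, hg, hdeg, hle⟩ := exists_mul_nonzeroCount_le p hp
    zify [hj.le] at hle
    zify at hdeg
    have hj' : (j : ℤ) < Fintype.card K := by exact_mod_cast hj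
    have hj0 : (0 : ℤ) ≤ j := by positivity
    rcases le_or_gt (j : ℤ) a with hja | hja
    · have h := ih g hg (a - j) (by linarith) (by linarith) (by linarith)
      generalize (Fintype.card K : ℤ) = Q at *
      have hQn : 0 ≤ Q ^ n := pow_nonneg (by linarith) n
      calc (Q - a) * Q ^ (n + 1) = (Q * (Q - a)) * Q ^ n := by ring
        _ ≤ ((Q - j) * (Q - (a - j))) * Q ^ n := by
            refine mul_le_mul_of_nonneg_right ?_ hQn
            nlinarith [mul_nonneg hj0 (sub_nonneg.2 hja)]
        _ = (Q - j) * ((Q - (a - j)) * Q ^ n) := by ring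
        _ ≤ (Q - j) * (Q * nonzeroCount g) := mul_le_mul_of_nonneg_left h (by linarith)
        _ = Q * ((Q - j) * nonzeroCount g) := by ring
        _ ≤ Q * nonzeroCount p := mul_le_mul_of_nonneg_left hle (by linarith)
    -- Here `g` has degree below `q - 1`, so the Schwartz-Zippel bound replaces the induction
    -- hypothesis; the slack is `(Q - j - 1) * (j - a)`.
    · have h := sub_mul_pow_le_mul_nonzeroCount g hg ((Fintype.card K : ℤ) - 1 + a - j)
        (by linarith)
      generalize (Fintype.card K : ℤ) = Q at *
      have hQn : 0 ≤ Q ^ (n + 1) := pow_nonneg (by linarith) _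
      calc (Q - a) * Q ^ (n + 1)
        _ ≤ ((Q - j) * (Q - (Q - 1 + a - j))) * Q ^ (n + 1) := by
            refine mul_le_mul_of_nonneg_right ?_ hQn
            have h1 : 0 ≤ Q - j - 1 := by linarith [Int.add_one_le_iff.2 hj']
            have h2 : 0 ≤ (j : ℤ) - a := by linarith
            nlinarith [mul_nonneg h1 h2]
        _ = (Q - j) * ((Q - (Q - 1 + a - j)) * Q ^ (n + 1)) := by ring
        _ ≤ (Q - j) * (Q * nonzeroCount g) := mul_le_mul_of_nonneg_left h (by linarith)
        _ = Q * ((Q - j) * nonzeroCount g) := by ring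
        _ ≤ Q * nonzeroCount p := mul_le_mul_of_nonneg_left hle (by linarith)

/-! ### From partial covers to polynomials -/

lemma PGPoint.liesOn_mk_iff {n : ℕ} {K : Type*} [Field K] {v : Fin (n + 1) → K} (hv : v ≠ 0)
    (W : Submodule K (Fin (n + 1) → K)) :
    PGPoint.LiesOn (Projectivization.mk K v hv) W ↔ v ∈ W := by
  rw [PGPoint.LiesOn, Projectivization.submodule_mk, Submodule.span_singleton_le_iff_mem]

lemma PGHyperplane.exists_ker_eq {n : ℕ} {K : Type*} [Field K] (H : PGHyperplane n K) :
    ∃ f : Module.Dual K (Fin (n + 1) → K), f ≠ 0 ∧ LinearMap.ker f = H.1 := by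
  have hlt : H.1 < ⊤ := by
    refine lt_top_iff_ne_top.2 fun h => ?_
    have := H.2
    rw [h, finrank_top, Module.finrank_fin_fun] at this
    omega
  obtain ⟨f, hf, hle⟩ := Submodule.exists_le_ker_of_lt_top H.1 hlt
  refine ⟨f, hf, (Submodule.eq_of_le_of_finrank_eq hle ?_).symm⟩
  have h := Module.Dual.finrank_ker_add_one_of_ne_zero hf
  rw [Module.finrank_fin_fun] at h
  rw [H.2]
  omega

open MvPolynomial in
/-- With one hyperplane of a nonempty partial cover taken as the hyperplane at infinity, the
nonzeros of a product of affine forms, one for each remaining hyperplane, are holes. -/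
lemma IsPartialCover.exists_polynomial {n : ℕ} {K : Type*} [Field K] [Fintype K] [DecidableEq K]
    {m : ℤ} {S : Finset (PGHyperplane n K)} (hS : IsPartialCover m S) (hne : S.Nonempty) :
    ∃ p : MvPolynomial (Fin n) K, (∃ x, eval x p ≠ 0) ∧ (p.totalDegree : ℤ) ≤ m - 1 ∧
      nonzeroCount p ≤ (holes S).ncard := by
  classical
  choose f hf0 hf using PGHyperplane.exists_ker_eq (n := n) (K := K)
  have hmem : ∀ (H : PGHyperplane n K) v, v ∈ H.1 ↔ f H v = 0 := fun H v => by
    rw [← hf, LinearMap.mem_ker]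
  obtain ⟨H₀, hH₀⟩ := hne
  obtain ⟨P, hP⟩ := hS.exists_hole
  induction P using Projectivization.ind with | h w hw => ?_
  have hw' : ∀ H ∈ S, f H w ≠ 0 := fun H hH h =>
    hP H hH ((PGPoint.liesOn_mk_iff hw _).2 ((hmem _ _).2 h))
  -- The hole, scaled onto the affine hyperplane `f H₀ = 1`, is the origin of the chart `φ`; hence
  -- `p` is nonzero at `0`.
  set u : Fin (n + 1) → K := (f H₀ w)⁻¹ • w with hu
  have hu0 : f H₀ u = 1 := by
    rw [hu, map_smul, smul_eq_mul, inv_mul_cancel₀ (hw' H₀ hH₀)]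
  have hu' : ∀ H ∈ S, f H u ≠ 0 := fun H hH => by
    rw [hu, map_smul, smul_eq_mul]
    exact mul_ne_zero (inv_ne_zero (hw' H₀ hH₀)) (hw' H hH)
  let b : Module.Basis (Fin n) K H₀.1 := Module.finBasisOfFinrankEq K H₀.1 H₀.2
  let φ : (Fin n → K) → Fin (n + 1) → K := fun x => u + ∑ i, x i • (b i : Fin (n + 1) → K)
  have hφH : ∀ H x, f H (φ x) = f H u + ∑ i, x i * f H (b i) := fun H x => by simp [φ]
  have hφ₀ : ∀ x, f H₀ (φ x) = 1 := fun x => by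
    rw [hφH, hu0, Finset.sum_eq_zero, add_zero]
    intro i _
    rw [(hmem H₀ _).1 (b i).2, mul_zero]
  have hφne : ∀ x, φ x ≠ 0 := fun x h => by
    have := hφ₀ x
    rw [h, map_zero] at this
    exact zero_ne_one this
  let p : MvPolynomial (Fin n) K :=
    ∏ H ∈ S.erase H₀, (C (f H u) + ∑ i, C (f H (b i)) * X i)
  have hp : ∀ x, eval x p = ∏ H ∈ S.erase H₀, f H (φ x) := fun x => by
    simp only [p, map_prod, map_add, map_sum, map_mul, eval_C, eval_X, hφH, mul_comm]
  refine ⟨p, ⟨0, ?_⟩, ?_, ?_⟩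
  · rw [hp, Finset.prod_ne_zero_iff]
    intro H hH
    rw [hφH]
    simpa using hu' H (Finset.mem_of_mem_erase hH)
  · have hdeg : p.totalDegree ≤ (S.erase H₀).card := by
      refine (totalDegree_finsetProd _ _).trans ?_
      rw [Finset.card_eq_sum_ones]
      refine Finset.sum_le_sum fun H _ => ?_
      refine (totalDegree_add _ _).trans (max_le (by simp) ?_)
      refine totalDegree_finsetSum_le fun i _ => ?_
      refine (totalDegree_mul _ _).trans ?_
      simp
    have h1 := Finset.card_erase_add_one hH₀
    have h2 := hS.card_eq
    omega
  · rw [nonzeroCount, ← Set.ncard_coe_finset]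
    refine Set.ncard_le_ncard_of_injOn (fun x => Projectivization.mk K (φ x) (hφne x)) ?_ ?_
      (Set.toFinite _)
    · intro x hx H hH
      rw [PGPoint.liesOn_mk_iff, hmem]
      rcases eq_or_ne H H₀ with rfl | hHne
      · rw [hφ₀]
        exact one_ne_zero
      · have hx' : eval x p ≠ 0 := by simpa using hx
        rw [hp, Finset.prod_ne_zero_iff] at hx'
        exact hx' H (Finset.mem_erase.2 ⟨hHne, hH⟩)
    · intro x _ y _ h
      obtain ⟨c, hc⟩ := (Projectivization.mk_eq_mk_iff' K _ _ (hφne x) (hφne y)).1 h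
      have hc1 : c = 1 := by
        have := congrArg (f H₀) hc
        rwa [map_smul, hφ₀, hφ₀, smul_eq_mul, mul_one] at this
      rw [hc1, one_smul] at hc
      have hsum := add_left_cancel hc
      have hsum' : ∑ i, y i • b i = ∑ i, x i • b i := by
        apply Subtype.ext
        simpa using hsum
      rw [← b.equivFun_symm_apply, ← b.equivFun_symm_apply] at hsum'
      exact (b.equivFun.symm.injective hsum').symm

/-- The lower bound for the number of holes of a partial `(q + a)`-cover of `PG(n, q)`. -/
theorem IsPartialCover.le_ncard_holes {n : ℕ} (hn : 2 ≤ n) {K : Type*} [Field K] [Finite K] {a : ℤ}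
    {S : Finset (PGHyperplane n K)} (hS : IsPartialCover ((Nat.card K : ℤ) + a) S) :
    (Nat.card K : ℤ) ^ (n - 1) - a * (Nat.card K : ℤ) ^ (n - 2) ≤ ((holes S).ncard : ℤ) := by
  classical
  have := Fintype.ofFinite K
  rw [Nat.card_eq_fintype_card] at *
  obtain ⟨n, rfl⟩ := Nat.exists_eq_add_of_le' hn
  rw [show n + 2 - 1 = n + 1 from rfl, Nat.add_sub_cancel]
  have hq : (1 : ℤ) < Fintype.card K := by exact_mod_cast Fintype.one_lt_card
  have hcard := hS.card_eq
  set Q : ℤ := ((Fintype.card K : ℕ) : ℤ) with hQ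
  have hQn : 0 < Q ^ n := pow_pos (by linarith) n
  -- With no hyperplane to send to infinity, `a = -q` and every point is a hole.
  rcases S.eq_empty_or_nonempty with rfl | hne
  · have hh : holes (∅ : Finset (PGHyperplane (n + 2) K)) = Set.univ := by
      simp [holes]
    rw [hh, Set.ncard_univ, Projectivization.card_of_finrank K _ (Module.finrank_fin_fun K),
      Nat.card_eq_fintype_card, Finset.sum_range_succ, Finset.sum_range_succ]
    have ha : a = -Q := by simpa [eq_neg_iff_add_eq_zero, add_comm] using hcard.symm
    push_cast
    rw [← hQ, ha]
    have h0 : 0 ≤ ∑ i ∈ Finset.range (n + 1), Q ^ i :=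
      Finset.sum_nonneg fun i _ => pow_nonneg (by linarith) i
    have h1 : Q ^ (n + 1) * 1 ≤ Q ^ (n + 1) * Q :=
      mul_le_mul_of_nonneg_left hq.le (pow_nonneg (by linarith) _)
    calc Q ^ (n + 1) - -Q * Q ^ n = Q ^ (n + 1) + Q ^ (n + 1) * 1 := by ring
      _ ≤ Q ^ (n + 1) + Q ^ (n + 1) * Q := by linarith
      _ ≤ _ := by rw [← pow_succ]; linarith
  obtain ⟨p, hp, hd, hle⟩ := hS.exists_polynomial hne
  zify at hle
  refine le_trans ?_ hle
  refine le_of_mul_le_mul_left ?_ (show 0 < Q by linarith)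
  rcases lt_or_ge a 0 with ha | ha
  · refine le_trans ?_ (sub_mul_pow_le_mul_nonzeroCount p hp _ hd)
    rw [← hQ]
    have h : Q - a ≤ (1 - a) * Q := by nlinarith
    calc Q * (Q ^ (n + 1) - a * Q ^ n) = (Q - a) * Q ^ n * Q := by ring
      _ ≤ (1 - a) * Q * Q ^ n * Q := by gcongr
      _ = (Q - (Q + a - 1)) * Q ^ (n + 2) := by ring
  rcases lt_or_ge a Q with haq | haq
  · refine le_trans ?_ (sub_mul_pow_le_sq_mul_nonzeroCount p hp a ha haq (by linarith))
    rw [← hQ]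
    exact le_of_eq (by ring)
  · have h : (Q - a) * Q ^ n ≤ 0 := mul_nonpos_of_nonpos_of_nonneg (by linarith) hQn.le
    calc Q * (Q ^ (n + 1) - a * Q ^ n) = Q * ((Q - a) * Q ^ n) := by ring
      _ ≤ 0 := mul_nonpos_of_nonneg_of_nonpos (by linarith) h
      _ ≤ _ := by positivity

/-! ### Covers attaining the bound -/

/-- The linear forms of the hyperplane `x₀ = 0` at infinity and of the affine coordinate
hyperplanes `xᵢ₊₁ = c x₀`. -/
def coordForm {n : ℕ} {K : Type*} [Field K] : Option (Fin n × K) → Module.Dual K (Fin (n + 1) → K)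
  | none => LinearMap.proj 0
  | some (i, c) => LinearMap.proj i.succ - c • LinearMap.proj 0

lemma coordForm_none {n : ℕ} {K : Type*} [Field K] (v : Fin (n + 1) → K) :
    coordForm none v = v 0 := rfl

lemma coordForm_some {n : ℕ} {K : Type*} [Field K] (i : Fin n) (c : K) (v : Fin (n + 1) → K) :
    coordForm (some (i, c)) v = v i.succ - c * v 0 := rfl

lemma coordForm_ne_zero {n : ℕ} {K : Type*} [Field K] (t : Option (Fin n × K)) :
    coordForm t ≠ 0 := by
  intro h
  rcases t with _ | ⟨i, c⟩
  · simpa [coordForm_none] using LinearMap.congr_fun h (Fin.cons 1 0)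
  · simpa [coordForm_some] using LinearMap.congr_fun h (Fin.cons 0 1)

/-- Test vectors separate the kernels: affine points separate infinity from the other hyperplanes
and parallel ones from each other, and points at infinity separate different directions. -/
lemma ker_coordForm_injective {n : ℕ} {K : Type*} [Field K] :
    Function.Injective fun t : Option (Fin n × K) => LinearMap.ker (coordForm t) := by
  intro s t h
  have key : ∀ v, coordForm s v = 0 ↔ coordForm t v = 0 := fun v => by
    rw [← LinearMap.mem_ker, ← LinearMap.mem_ker]
    exact iff_of_eq (congrArg (v ∈ ·) h)
  rcases s with _ | ⟨i, c⟩ <;> rcases t with _ | ⟨j, d⟩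
  · rfl
  · simpa [coordForm_none, coordForm_some] using key (Fin.cons 1 fun _ => d)
  · simpa [coordForm_none, coordForm_some] using key (Fin.cons 1 fun _ => c)
  · have hij : i = j := by
      by_contra hij
      simpa [coordForm_some, Pi.single_apply, Ne.symm hij] using key (Fin.cons 0 (Pi.single i 1))
    subst hij
    have hcd : c = d := by
      simpa [coordForm_some, sub_eq_zero] using key (Fin.cons 1 fun _ => c)
    rw [hcd]

/-- The hyperplanes `x₀ = 0` and `xᵢ₊₁ = c x₀`. -/
def coordHyperplane {n : ℕ} {K : Type*} [Field K] : Option (Fin n × K) ↪ PGHyperplane n K where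
  toFun t := ⟨LinearMap.ker (coordForm t), by
    have h := Module.Dual.finrank_ker_add_one_of_ne_zero (coordForm_ne_zero t)
    rw [Module.finrank_fin_fun] at h
    omega⟩
  inj' _ _ h := ker_coordForm_injective (congrArg Subtype.val h)

lemma liesOn_coordHyperplane_iff {n : ℕ} {K : Type*} [Field K] {v : Fin (n + 1) → K} (hv : v ≠ 0)
    (t : Option (Fin n × K)) :
    PGPoint.LiesOn (Projectivization.mk K v hv) (coordHyperplane t).1 ↔ coordForm t v = 0 := by
  rw [PGPoint.liesOn_mk_iff]
  exact LinearMap.mem_ker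

/-- The point of `PG(n, q)` with affine coordinates `y`. -/
def affinePoint {n : ℕ} {K : Type*} [Field K] (y : Fin n → K) : PGPoint n K :=
  Projectivization.mk K (Fin.cons 1 y : Fin (n + 1) → K) fun h => one_ne_zero (congrFun h 0)

lemma affinePoint_injective {n : ℕ} {K : Type*} [Field K] :
    Function.Injective (affinePoint (n := n) (K := K)) := by
  intro x y h
  obtain ⟨c, hc⟩ := (Projectivization.mk_eq_mk_iff' K _ _ _ _).1 h
  have hc1 : c = 1 := by simpa using congrFun hc 0
  rw [hc1, one_smul] at hc
  exact (Fin.cons_injective2 hc).2.symm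

/-- The holes of a set of hyperplanes `xᵢ₊₁ = c x₀`, together with the hyperplane at infinity,
are affine points. -/
lemma holes_map_coordHyperplane {n : ℕ} {K : Type*} [Field K] (T : Finset (Fin n × K)) :
    holes (T.insertNone.map coordHyperplane) =
      affinePoint '' {y : Fin n → K | ∀ i c, (i, c) ∈ T → y i ≠ c} := by
  ext P
  constructor
  · induction P using Projectivization.ind with | h v hv => ?_
    intro hP
    have hP' : ∀ t ∈ T.insertNone, coordForm t v ≠ 0 := fun t ht h =>
      hP _ (Finset.mem_map_of_mem _ ht) ((liesOn_coordHyperplane_iff hv t).2 h)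
    have hv0 : v 0 ≠ 0 := hP' none (Finset.none_mem_insertNone)
    refine ⟨fun i => (v 0)⁻¹ * v i.succ, fun i c hic h => ?_, ?_⟩
    · apply hP' (some (i, c)) (Finset.some_mem_insertNone.2 hic)
      rw [coordForm_some, ← h]
      field_simp
      ring
    · refine (Projectivization.mk_eq_mk_iff' K _ _ _ _).2 ⟨(v 0)⁻¹, ?_⟩
      ext i
      refine Fin.cases ?_ (fun i => ?_) i
      · simp [hv0]
      · simp
  · rintro ⟨y, hy, rfl⟩ H hH
    obtain ⟨t, ht, rfl⟩ := Finset.mem_map.1 hH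
    rw [affinePoint, liesOn_coordHyperplane_iff]
    rcases t with _ | ⟨i, c⟩
    · simp [coordForm_none]
    · have := hy i c (Finset.some_mem_insertNone.1 ht)
      simpa [coordForm_some, sub_eq_zero] using this

/-- For `0 ≤ a < q` some partial `(q + a)`-cover of `PG(n, q)` attains the bound: the hyperplane
`x₀ = 0`, the `q - 1` hyperplanes `x₁ = c x₀` with `c ≠ 0`, and `a` hyperplanes `x₂ = c x₀`. -/
theorem exists_isPartialCover_ncard_holes_eq {n : ℕ} (hn : 2 ≤ n) (K : Type*) [Field K] [Finite K]
    {a : ℤ} (ha : 0 ≤ a) (haq : a < Nat.card K) :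
    ∃ S : Finset (PGHyperplane n K), IsPartialCover ((Nat.card K : ℤ) + a) S ∧
      ((holes S).ncard : ℤ) =
        (Nat.card K : ℤ) ^ (n - 1) - a * (Nat.card K : ℤ) ^ (n - 2) := by
  classical
  have := Fintype.ofFinite K
  rw [Nat.card_eq_fintype_card] at *
  obtain ⟨n, rfl⟩ := Nat.exists_eq_add_of_le' hn
  rw [show n + 2 - 1 = n + 1 from rfl, Nat.add_sub_cancel]
  lift a to ℕ using ha
  have haq : a < Fintype.card K := by exact_mod_cast haq
  obtain ⟨A, -, hA⟩ := Finset.exists_subset_card_eq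
    (s := (Finset.univ : Finset K)) (n := a) (by rw [Finset.card_univ]; exact haq.le)
  -- `B i` collects the values forbidden for the `i`-th affine coordinate, so the holes are the
  -- product of the complements.
  obtain ⟨B, hB₀, hB₁, hB⟩ : ∃ B : Fin (n + 2) → Finset K, B 0 = {0}ᶜ ∧ B (Fin.succ 0) = A ∧
      ∀ i : Fin n, B i.succ.succ = ∅ :=
    ⟨Fin.cons {0}ᶜ (Fin.cons A fun _ => ∅), rfl, rfl, fun _ => rfl⟩
  let T : Finset (Fin (n + 2) × K) := Finset.univ.filter fun z => z.2 ∈ B z.1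
  have hT : T.card = Fintype.card K - 1 + a := by
    have h : T = Finset.univ.biUnion fun i => (B i).map ⟨Prod.mk i, Prod.mk_right_injective i⟩ := by
      ext ⟨i, c⟩
      simp [T]
    rw [h, Finset.card_biUnion]
    · simp only [Finset.card_map]
      rw [Fin.sum_univ_succ, Fin.sum_univ_succ, hB₀, hB₁]
      simp [hB, hA, Finset.card_compl]
    · intro i _ j _ hij
      rw [Function.onFun, Finset.disjoint_left]
      simp only [Finset.mem_map, Function.Embedding.coeFn_mk]
      rintro _ ⟨c, _, rfl⟩ ⟨d, _, h⟩
      exact hij (congrArg Prod.fst h).symm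
  have hholes : ((holes (T.insertNone.map coordHyperplane)).ncard : ℤ) =
      (Fintype.card K : ℤ) ^ (n + 1) - a * (Fintype.card K : ℤ) ^ n := by
    have hset : {y : Fin (n + 2) → K | ∀ i c, (i, c) ∈ T → y i ≠ c} =
        (Fintype.piFinset fun i => (B i)ᶜ : Finset (Fin (n + 2) → K)) := by
      ext y
      simp only [Set.mem_ofPred_eq, Finset.mem_coe, Fintype.mem_piFinset, Finset.mem_compl, T,
        Finset.mem_filter, Finset.mem_univ, true_and]
      exact ⟨fun h i hi => h i _ hi rfl, fun h i c hc hyc => h i (hyc ▸ hc)⟩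
    rw [holes_map_coordHyperplane, Set.ncard_image_of_injective _ affinePoint_injective, hset,
      Set.ncard_coe_finset, Fintype.card_piFinset, Fin.prod_univ_succ, Fin.prod_univ_succ,
      hB₀, hB₁]
    simp [hB, hA, Finset.card_compl, Nat.cast_sub haq.le]
    ring
  refine ⟨T.insertNone.map coordHyperplane, ⟨?_, ?_⟩, hholes⟩
  · rw [Finset.card_map, Finset.card_insertNone, hT]
    have := Fintype.card_pos (α := K)
    omega
  · have hpos : (0 : ℤ) < (holes (T.insertNone.map coordHyperplane)).ncard := by
      rw [hholes, pow_succ']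
      rw [← sub_mul]
      have : (a : ℤ) < Fintype.card K := by exact_mod_cast haq
      exact mul_pos (by linarith) (pow_pos (by linarith [Int.natCast_nonneg a]) n)
    exact Set.nonempty_of_ncard_ne_zero (by omega)

theorem theorem14 (K : Type*) [Field K] [Finite K] (q : ℕ) (hq : Nat.card K = q)
    (n : ℕ) (hn : 2 ≤ n) :
    -- the bound under the assumption `(A_x)` for all `x ≤ a`
    (∀ a : ℤ, (∀ x : ℤ, x ≤ a → PropertyA K x) →
      ∀ S : Finset (PGHyperplane n K), IsPartialCover ((q : ℤ) + a) S →
        (q : ℤ) ^ (n - 1) - a * (q : ℤ) ^ (n - 2) ≤ ((holes S).ncard : ℤ)) ∧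
    -- the unconditional bound
    (13 < q → ∀ a : ℤ, (a : ℚ) ≤ ((q : ℚ) - 10) / 4 →
      ∀ S : Finset (PGHyperplane n K), IsPartialCover ((q : ℤ) + a) S →
        (q : ℤ) ^ (n - 1) - a * (q : ℤ) ^ (n - 2) ≤ ((holes S).ncard : ℤ)) ∧
    -- sharpness
    (∀ a : ℤ, 0 ≤ a → a < (q : ℤ) →
      ∃ S : Finset (PGHyperplane n K), IsPartialCover ((q : ℤ) + a) S ∧
        ((holes S).ncard : ℤ) = (q : ℤ) ^ (n - 1) - a * (q : ℤ) ^ (n - 2)) := by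
  subst hq
  exact ⟨fun _ _ _ hS => hS.le_ncard_holes hn, fun _ _ _ _ hS => hS.le_ncard_holes hn,
    fun _ ha haq => exists_isPartialCover_ncard_holes_eq hn K ha haq⟩
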